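/- Let $k$ be a field of characteristic $0$. Let $\mathcal F$ be the fermionic Fock space over $k$. It carries free fermion operators $\psi_n,\psi_n^*$ ($n\in\mathbb Z$) satisfying $$\psi_m\psi_n+\psi_n\psi_m=\psi^*_m\psi^*_n+\psi^*_n\psi^*_m=0,\qquad \psi_m\psi^*_n+\psi^*_n\psi_m=\delta_{m,n},$$ and a vacuum vector $|0\rangle$ with $\psi_m|0\rangle=\psi^*_n|0\rangle=0$ for $m<0\le n$. The vectors $\psi_{n_1}\cdots\psi_{n_p}\psi^*_{m_1}\cdots\psi^*_{m_q}|0\rangle$ with $p,q\ge 0$ and $n_1>\dots>n_p\ge 0>m_q>\dots>m_1$ form a basis of $\mathcal F$. Let $\langle 0|\colon\mathcal F\to k$, $|v\rangle\mapsto\langle 0|v\rangle$, be the unique linear functional with $\langle 0|0\rangle=1$ and $\langle 0|\psi_n=\langle 0|\psi^*_m=0$ for $m<0\le n$. For $r\ge 0$ put $|{-r}\rangle=\psi^*_{-r}\cdots\psi^*_{-2}\psi^*_{-1}|0\rangle$. For $m>0$ let $a_m=\sum_{i\in\mathbb Z}\psi_i\psi^*_{i+m}$. For finite (possibly empty) tuples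 $x=(x_1,\dots,x_M)$ and $y=(y_1,\dots,y_N)$ of elements of $k$ (for instance, indeterminates whose rational functions lie in $k$), put $$p_n(x/y)=\sum_{j}x_j^n-\sum_{l}y_l^n,\qquad H(x/y)=\sum_{n>0}\frac{p_n(x/y)}{n}\,a_n,\qquad \sum_{n\ge 0}h_n(x/y)z^n=\prod_{j=1}^M\frac1{1-x_jz}\prod_{l=1}^N(1-y_lz),$$ and $h_n(x/y)=0$ for $n<0$. On each vector of $\mathcal F$ only finitely many terms of the sums $a_m$, $H(x/y)$ and $e^{\pm H(x/y)}=\sum_{n\ge0}(\pm H(x/y))^n/n!$ are nonzero, so these are linear operators on $\mathcal F$. **Proposition.** Let $r\ge 0$, let $\lambda=(\lambda_1\ge\dots\ge\lambda_r\ge 0)$ be a partition with at most $r$ nonzero parts, and let $x^{(1)},\dots,x^{(r)}$ and $y^{(1)},\dots,y^{(r)}$ be finite tuples of elements of $k$, of arbitrary lengths. Define $$S_\lambda(\mathbf x/\mathbf y)=\langle 0|\left(e^{H(x^{(1)}/y^{(1)})}\psi_{\lambda_1-1}e^{-H(x^{(1)}/y^{(1)})}\right)\cdots\left(e^{H(x^{(r)}/y^{(r)})}\psi_{\lambda_r-r}e^{-H(x^{(r)}/y^{(r)})}\right)|{-r}\rangle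 .$$ Then $$S_\lambda(\mathbf x/\mathbf y)=\det\left(h_{\lambda_i-i+j}(x^{(i)}/y^{(i)})\right)_{1\le i,j\le r}.$$ The determinant on the right is the Jacobi–Trudi form of the multi-Schur function. -/

import Mathlib

noncomputable section

namespace MultiSchur

/-! ### The fermionic Fock space

The Fock space over `K` is realized as the exterior algebra on a free module with one generator
`e n` for every integer `n`.  The generator `e n` stands for the creation operator `ψ_n` if `0 ≤ n`
and for the creation operator `ψ*_n` if `n < 0`.  The unit `1` is the vacuum `|0⟩`, and the
ordered monomials in the `e n` are the basis vectors
`ψ_{n₁} ⋯ ψ_{n_r} ψ*_{m₁} ⋯ ψ*_{m_s} |0⟩`, `n₁ > ⋯ > n_r ≥ 0 > m_s > ⋯ > m₁`. -/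

/-- The fermionic Fock space. -/
abbrev Fock (K : Type*) [Field K] : Type _ := ExteriorAlgebra K (ℤ →₀ K)

variable {K : Type*} [Field K]

/-- Left (exterior) multiplication by the generator `e n`. -/
def create (n : ℤ) : Module.End K (Fock K) :=
  LinearMap.mulLeft K (ExteriorAlgebra.ι K (Finsupp.single n (1 : K)))

/-- Contraction (interior product) with the coordinate functional dual to `e n`. -/
def annihilate (n : ℤ) : Module.End K (Fock K) :=
  CliffordAlgebra.contractLeft (Finsupp.lapply n : (ℤ →₀ K) →ₗ[K] K)

/-- The free fermion `ψ_n` acting on the Fock space. -/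
def psi (n : ℤ) : Module.End K (Fock K) := if 0 ≤ n then create n else annihilate n

/-- The free fermion `ψ*_n` acting on the Fock space. -/
def psiStar (n : ℤ) : Module.End K (Fock K) := if 0 ≤ n then annihilate n else create n

/-- The vacuum vector `|0⟩`. -/
def vac : Fock K := 1

/-- The dual vacuum `⟨0|`, as the linear functional `|v⟩ ↦ ⟨0|v⟩`: the scalar part of an element
of the exterior algebra. -/
def bra0 : Fock K →ₗ[K] K := ExteriorAlgebra.algebraMapInv.toLinearMap

/-- The vacuum expectation value `⟨X⟩ = ⟨0|X|0⟩` of an operator. -/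
def vev (X : Module.End K (Fock K)) : K := bra0 (X vac)

/-! The creation and annihilation operators and the free fermion relations. -/

theorem create_create (m n : ℤ) :
    (create m * create n + create n * create m : Module.End K (Fock K)) = 0 := by
  refine LinearMap.ext fun v => ?_
  simp only [create, LinearMap.add_apply, Module.End.mul_apply, LinearMap.mulLeft_apply,
    LinearMap.zero_apply, ← mul_assoc, ← add_mul]
  rw [ExteriorAlgebra.ι_add_mul_swap, zero_mul]

theorem annihilate_annihilate (m n : ℤ) :
    (annihilate m * annihilate n + annihilate n * annihilate m : Module.End K (Fock K)) = 0 := by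
  refine LinearMap.ext fun v => ?_
  simp only [annihilate, LinearMap.add_apply, Module.End.mul_apply, LinearMap.zero_apply]
  rw [CliffordAlgebra.contractLeft_comm, neg_add_cancel]

theorem annihilate_create (m n : ℤ) :
    (annihilate m * create n + create n * annihilate m : Module.End K (Fock K)) =
      if m = n then 1 else 0 := by
  refine LinearMap.ext fun v => ?_
  simp only [annihilate, create, LinearMap.add_apply, Module.End.mul_apply,
    LinearMap.mulLeft_apply]
  rw [ExteriorAlgebra.ι, CliffordAlgebra.contractLeft_ι_mul, sub_add_cancel]
  by_cases h : m = n
  · simp [h]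
  · simp [h, Ne.symm h]

theorem psi_psi (m n : ℤ) :
    (psi m * psi n + psi n * psi m : Module.End K (Fock K)) = 0 := by
  unfold psi
  split_ifs with h1 h2 h2
  · exact create_create m n
  · rw [add_comm, annihilate_create, if_neg (by omega)]
  · rw [annihilate_create, if_neg (by omega)]
  · exact annihilate_annihilate m n

theorem psiStar_psiStar (m n : ℤ) :
    (psiStar m * psiStar n + psiStar n * psiStar m : Module.End K (Fock K)) = 0 := by
  unfold psiStar
  split_ifs with h1 h2 h2
  · exact annihilate_annihilate m n
  · rw [annihilate_create, if_neg (by omega)]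
  · rw [add_comm, annihilate_create, if_neg (by omega)]
  · exact create_create m n

theorem psi_psiStar (m n : ℤ) :
    (psi m * psiStar n + psiStar n * psi m : Module.End K (Fock K)) =
      if m = n then 1 else 0 := by
  unfold psi psiStar
  split_ifs with h1 h2 h3 h3 h2 h3 h3
  · rw [add_comm, annihilate_create, if_pos h3.symm]
  · rw [add_comm, annihilate_create, if_neg (Ne.symm h3)]
  · omega
  · exact create_create m n
  · omega
  · exact annihilate_annihilate m n
  · rw [annihilate_create, if_pos h3]
  · rw [annihilate_create, if_neg h3]

/-! The vacuum relations; together with `⟨0|0⟩ = 1` they determine `⟨0|`. -/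

theorem annihilate_vac (n : ℤ) : annihilate n (vac : Fock K) = 0 :=
  CliffordAlgebra.contractLeft_one (Q := (0 : QuadraticForm K (ℤ →₀ K))) _

theorem psi_vac {n : ℤ} (h : n < 0) : psi n (vac : Fock K) = 0 := by
  rw [psi, if_neg (by omega)]
  exact annihilate_vac n

theorem psiStar_vac {n : ℤ} (h : 0 ≤ n) : psiStar n (vac : Fock K) = 0 := by
  rw [psiStar, if_pos h]
  exact annihilate_vac n

theorem bra0_vac : bra0 (vac : Fock K) = 1 := by
  simp [bra0, vac]

theorem bra0_create (n : ℤ) (v : Fock K) : bra0 (create n v) = 0 := by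
  simp [bra0, create, ExteriorAlgebra.algebraMapInv]

theorem bra0_psi {n : ℤ} (h : 0 ≤ n) (v : Fock K) : bra0 (psi n v) = 0 := by
  rw [psi, if_pos h, bra0_create]

theorem bra0_psiStar {n : ℤ} (h : n < 0) (v : Fock K) : bra0 (psiStar n v) = 0 := by
  rw [psiStar, if_neg (by omega), bra0_create]

/-! ### Shifted vacuum vectors -/

/-- `ψ_{m-1} ⋯ ψ_1 ψ_0 |0⟩`. -/
def vacPos : ℕ → Fock K
  | 0 => vac
  | m + 1 => psi (m : ℤ) (vacPos m)

/-- `ψ*_{-m} ⋯ ψ*_{-2} ψ*_{-1} |0⟩`. -/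
def vacNeg : ℕ → Fock K
  | 0 => vac
  | m + 1 => psiStar (-((m : ℤ) + 1)) (vacNeg m)

/-- The shifted vacuum vector `|m⟩`. -/
def shiftedVac (m : ℤ) : Fock K := if 0 ≤ m then vacPos m.toNat else vacNeg (-m).toNat

/-! ### The energy filtration

It is used only to see that the infinite sums below are finite on every vector. -/

/-- The span of the monomials in the `e n` of total energy at most `d`, where `e n` has energy
`|n|`. -/
def energyLE (d : ℤ) : Submodule K (Fock K) :=
  Submodule.span K {v | ∃ l : List ℤ, (l.map abs).sum ≤ d ∧ v = (l.map create).prod vac}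

theorem energyLE_mono {d d' : ℤ} (h : d ≤ d') :
    (energyLE d : Submodule K (Fock K)) ≤ energyLE d' := by
  apply Submodule.span_mono
  rintro v ⟨l, hl, rfl⟩
  exact ⟨l, hl.trans h, rfl⟩

theorem energyLE_neg {d : ℤ} (h : d < 0) : (energyLE d : Submodule K (Fock K)) = ⊥ := by
  rw [energyLE, Submodule.span_eq_bot]
  rintro v ⟨l, hl, rfl⟩
  have : 0 ≤ (l.map abs).sum := by
    apply List.sum_nonneg
    intro a ha
    obtain ⟨b, -, rfl⟩ := List.mem_map.1 ha
    exact abs_nonneg b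
  omega

theorem create_energy (n d : ℤ) {v : Fock K} (hv : v ∈ energyLE d) :
    create n v ∈ energyLE (d + |n|) := by
  induction hv using Submodule.span_induction with
  | mem v hv =>
    obtain ⟨l, hl, rfl⟩ := hv
    apply Submodule.subset_span
    exact ⟨n :: l, by simp; omega, by simp⟩
  | zero => simp
  | add v w _ _ hv hw => rw [map_add]; exact Submodule.add_mem _ hv hw
  | smul c v _ hv => rw [map_smul]; exact Submodule.smul_mem _ _ hv

theorem annihilate_energy (n d : ℤ) {v : Fock K} (hv : v ∈ energyLE d) :
    annihilate n v ∈ energyLE (d - |n|) := by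
  induction hv using Submodule.span_induction with
  | mem v hv =>
    obtain ⟨l, hl, rfl⟩ := hv
    induction l generalizing d with
    | nil =>
      simp [annihilate_vac]
    | cons a l ih =>
      simp only [List.map_cons, List.sum_cons] at hl
      simp only [List.map_cons, List.prod_cons, Module.End.mul_apply]
      have h := congrArg (fun T : Module.End K (Fock K) => T ((l.map create).prod vac))
        (annihilate_create (K := K) n a)
      simp only [LinearMap.add_apply, Module.End.mul_apply] at h
      rw [eq_sub_of_add_eq h]
      apply Submodule.sub_mem
      · split_ifs with hna
        · subst hna
          exact Submodule.subset_span ⟨l, by omega, rfl⟩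
        · simp
      · have := create_energy a _ (ih (d - |a|) (by omega))
        exact energyLE_mono (by omega) this
  | zero => simp
  | add v w _ _ hv hw => rw [map_add]; exact Submodule.add_mem _ hv hw
  | smul c v _ hv => rw [map_smul]; exact Submodule.smul_mem _ _ hv

theorem psi_energy (n d : ℤ) {v : Fock K} (hv : v ∈ energyLE d) :
    psi n v ∈ energyLE (d + n) := by
  unfold psi
  split_ifs with h
  · simpa [abs_of_nonneg h] using create_energy n d hv
  · simpa [abs_of_neg (not_le.1 h)] using annihilate_energy n d hv

theorem psiStar_energy (n d : ℤ) {v : Fock K} (hv : v ∈ energyLE d) :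
    psiStar n v ∈ energyLE (d - n) := by
  unfold psiStar
  split_ifs with h
  · simpa [abs_of_nonneg h] using annihilate_energy n d hv
  · simpa [abs_of_neg (not_le.1 h), sub_eq_add_neg] using create_energy n d hv

theorem psi_eq_zero {n d : ℤ} (h : d + n < 0) {v : Fock K} (hv : v ∈ energyLE d) :
    psi n v = 0 := by
  simpa [energyLE_neg h] using psi_energy n d hv

theorem psiStar_eq_zero {n d : ℤ} (h : d < n) {v : Fock K} (hv : v ∈ energyLE d) :
    psiStar n v = 0 := by
  simpa [energyLE_neg (sub_neg.2 h)] using psiStar_energy n d hv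

theorem exists_energyLE (v : Fock K) : ∃ d : ℕ, v ∈ energyLE (d : ℤ) := by
  have step : ∀ (u : ℤ →₀ K) (w : Fock K), (∃ d : ℕ, w ∈ energyLE (d : ℤ)) →
      ∃ d : ℕ, ExteriorAlgebra.ι K u * w ∈ energyLE (d : ℤ) := by
    rintro u w ⟨d, hd⟩
    induction u using Finsupp.induction_linear with
    | zero => exact ⟨0, by simp⟩
    | add f g hf hg =>
      obtain ⟨a, ha⟩ := hf
      obtain ⟨b, hb⟩ := hg
      refine ⟨max a b, ?_⟩
      rw [map_add, add_mul]
      exact Submodule.add_mem _ (energyLE_mono (by simp) ha) (energyLE_mono (by simp) hb)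
    | single n c =>
      refine ⟨d + n.natAbs, ?_⟩
      have h : ExteriorAlgebra.ι K (Finsupp.single n c) * w = c • create n w := by
        rw [create, LinearMap.mulLeft_apply, ← smul_mul_assoc, ← map_smul]
        simp
      rw [h]
      apply Submodule.smul_mem
      simpa using create_energy n d hd
  induction v using CliffordAlgebra.left_induction with
  | algebraMap c =>
    refine ⟨0, ?_⟩
    rw [Algebra.algebraMap_eq_smul_one]
    exact Submodule.smul_mem _ _ (Submodule.subset_span ⟨[], by simp, by simp [vac]⟩)
  | add x y hx hy =>
    obtain ⟨a, ha⟩ := hx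
    obtain ⟨b, hb⟩ := hy
    exact ⟨max a b, Submodule.add_mem _ (energyLE_mono (by simp) ha) (energyLE_mono (by simp) hb)⟩
  | ι_mul x m hx => exact step m x hx

/-- The vacuum relations characterize `⟨0|`. -/
theorem bra0_unique (f : Fock K →ₗ[K] K) (h1 : f vac = 1)
    (hpsi : ∀ n : ℤ, 0 ≤ n → ∀ v, f (psi n v) = 0)
    (hpsiStar : ∀ n : ℤ, n < 0 → ∀ v, f (psiStar n v) = 0) : f = bra0 := by
  refine LinearMap.ext fun v => ?_
  obtain ⟨d, hd⟩ := exists_energyLE v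
  induction hd using Submodule.span_induction with
  | mem v hv =>
    obtain ⟨l, -, rfl⟩ := hv
    cases l with
    | nil => simp [h1, bra0_vac]
    | cons a l =>
      simp only [List.map_cons, List.prod_cons, Module.End.mul_apply]
      rw [bra0_create]
      rcases lt_or_ge a 0 with h | h
      · have := hpsiStar a h ((l.map create).prod vac)
        rwa [psiStar, if_neg (not_le.2 h)] at this
      · have := hpsi a h ((l.map create).prod vac)
        rwa [psi, if_pos h] at this
  | zero => simp
  | add v w _ _ hv hw => rw [map_add, map_add, hv, hw]
  | smul c v _ hv => rw [map_smul, map_smul, hv]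

/-! ### Locally finite sums and locally nilpotent exponentials of operators -/

section Operators

variable {V : Type*} [AddCommGroup V] [Module K V]

/-- The sum of a family of operators of which only finitely many are nonzero on each vector. -/
def locSum {ι : Type*} (T : ι → Module.End K V) (hT : ∀ v, {i | T i v ≠ 0}.Finite) :
    Module.End K V where
  toFun v := ∑ᶠ i, T i v
  map_add' v w := by
    simp only [map_add]
    exact finsum_add_distrib (hT v) (hT w)
  map_smul' c v := by
    simp only [map_smul, RingHom.id_apply]
    exact (smul_finsum' c (hT v)).symm

/-- Every vector is killed by some power of the operator. -/
def LocNilpotent (T : Module.End K V) : Prop := ∀ v, ∃ n : ℕ, (T ^ n) v = 0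

theorem LocNilpotent.neg {T : Module.End K V} (hT : LocNilpotent T) : LocNilpotent (-T) := by
  intro v
  obtain ⟨n, hn⟩ := hT v
  refine ⟨n, ?_⟩
  rcases Nat.even_or_odd n with h | h
  · rw [h.neg_pow, hn]
  · rw [h.neg_pow, LinearMap.neg_apply, hn, neg_zero]

theorem LocNilpotent.finite {T : Module.End K V} (hT : LocNilpotent T) (v : V) :
    {n : ℕ | ((n.factorial : K)⁻¹ • T ^ n) v ≠ 0}.Finite := by
  obtain ⟨n, hn⟩ := hT v
  refine (Set.finite_lt_nat n).subset ?_
  intro m hm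
  by_contra h
  apply hm
  have h' : m = (m - n) + n := by simp only [Set.mem_ofPred_eq] at h; omega
  rw [LinearMap.smul_apply, h', pow_add, Module.End.mul_apply, hn, map_zero, smul_zero]

/-- The exponential `∑ Tⁿ / n!` of a locally nilpotent operator. -/
def locExp (T : Module.End K V) (hT : LocNilpotent T) : Module.End K V :=
  locSum (fun n : ℕ => (n.factorial : K)⁻¹ • T ^ n) hT.finite

end Operators

/-! ### Heisenberg operators -/

/-- The normally ordered product `:ψ_i ψ*_j: = ψ_i ψ*_j - ⟨ψ_i ψ*_j⟩`. -/
def normalOrder (i j : ℤ) : Module.End K (Fock K) :=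
  psi i * psiStar j - vev (K := K) (psi i * psiStar j) • (1 : Module.End K (Fock K))

theorem vev_psi_psiStar (i j : ℤ) :
    vev (psi i * psiStar j : Module.End K (Fock K)) = if i = j ∧ j < 0 then 1 else 0 := by
  rw [vev, Module.End.mul_apply]
  by_cases hj : 0 ≤ j
  · rw [psiStar_vac hj, map_zero, map_zero, if_neg (by omega)]
  · by_cases hi : 0 ≤ i
    · rw [bra0_psi hi, if_neg (by omega)]
    · have h := congrArg (fun T : Module.End K (Fock K) => bra0 (T vac))
        (psi_psiStar (K := K) i j)
      simp only [LinearMap.add_apply, Module.End.mul_apply, psi_vac (not_le.1 hi), map_zero,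
        add_zero] at h
      rw [h]
      by_cases hij : i = j
      · rw [if_pos hij, if_pos ⟨hij, by omega⟩, Module.End.one_apply, bra0_vac]
      · rw [if_neg hij, if_neg (by tauto), LinearMap.zero_apply, map_zero]

theorem normalOrder_finite (m : ℤ) (v : Fock K) :
    {i : ℤ | normalOrder i (i + m) v ≠ 0}.Finite := by
  obtain ⟨d, hd⟩ := exists_energyLE v
  refine (Set.finite_Icc (-(d : ℤ) - |m|) (d + |m|)).subset ?_
  intro i hi
  by_contra hout
  apply hi
  have hm1 := le_abs_self m
  have hm2 := neg_abs_le m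
  rw [Set.mem_Icc, not_and_or, not_le, not_le] at hout
  rw [normalOrder, vev_psi_psiStar]
  rcases hout with h | h
  · have hneg : i + m < 0 := by omega
    have hcar := congrArg (fun T : Module.End K (Fock K) => T v) (psi_psiStar (K := K) i (i + m))
    simp only [LinearMap.add_apply, Module.End.mul_apply,
      psi_eq_zero (show (d : ℤ) + i < 0 by omega) hd, map_zero, add_zero] at hcar
    rw [LinearMap.sub_apply, Module.End.mul_apply, hcar]
    by_cases h0 : i = i + m
    · rw [if_pos h0, if_pos ⟨h0, hneg⟩, one_smul, sub_self]
    · rw [if_neg h0, if_neg (by tauto), zero_smul, sub_self]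
  · rw [if_neg (by omega), zero_smul, sub_zero, Module.End.mul_apply,
      psiStar_eq_zero (show (d : ℤ) < i + m by omega) hd, map_zero]

/-- The Heisenberg operator `a_m = ∑_{i ∈ ℤ} :ψ_i ψ*_{i+m}:`. -/
def heis (m : ℤ) : Module.End K (Fock K) :=
  locSum (fun i : ℤ => normalOrder i (i + m)) (normalOrder_finite m)

theorem locSum_mem {V ι : Type*} [AddCommGroup V] [Module K V] (T : ι → Module.End K V)
    (hT : ∀ v, {i | T i v ≠ 0}.Finite) (S : Submodule K V) (v : V) (h : ∀ i, T i v ∈ S) :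
    locSum T hT v ∈ S :=
  finsum_induction (· ∈ S) S.zero_mem (fun _ _ => S.add_mem) h

theorem heis_energy {m : ℤ} (hm : 0 < m) (d : ℤ) {v : Fock K} (hv : v ∈ energyLE d) :
    heis m v ∈ energyLE (d - m) := by
  apply locSum_mem
  intro i
  rw [normalOrder, vev_psi_psiStar, if_neg (by omega), zero_smul, sub_zero,
    Module.End.mul_apply]
  have := psi_energy i _ (psiStar_energy (i + m) d hv)
  exact energyLE_mono (by omega) this

/-! ### Supersymmetric functions and the operator `H(x/y)` -/

section Super

variable {M N : ℕ} (x : Fin M → K) (y : Fin N → K)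

/-- The supersymmetric power sum `p_n(x/y) = ∑ x_jⁿ - ∑ y_lⁿ`. -/
def powerSum (n : ℕ) : K := (∑ j, x j ^ n) - ∑ l, y l ^ n

/-- The complete supersymmetric function `h_n(x/y)`, the coefficient of `zⁿ` in
`∏ (1 - x_j z)⁻¹ ∏ (1 - y_l z)`; it is zero for negative `n`. -/
def complete (n : ℤ) : K :=
  if 0 ≤ n then
    PowerSeries.coeff n.toNat
      ((∏ j, (1 - PowerSeries.C (x j) * PowerSeries.X)⁻¹) *
        ∏ l, (1 - PowerSeries.C (y l) * PowerSeries.X))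
  else 0

theorem opH_finite (v : Fock K) :
    {n : ℕ | ((powerSum x y (n + 1) / ((n : K) + 1)) • heis ((n : ℤ) + 1)) v ≠ 0}.Finite := by
  obtain ⟨d, hd⟩ := exists_energyLE v
  refine (Set.finite_lt_nat d).subset ?_
  intro n hn
  by_contra h
  apply hn
  have hdn : (d : ℤ) - ((n : ℤ) + 1) < 0 := by simp only [Set.mem_ofPred_eq] at h; omega
  have := heis_energy (show (0 : ℤ) < (n : ℤ) + 1 by omega) d hd
  rw [energyLE_neg hdn, Submodule.mem_bot] at this
  rw [LinearMap.smul_apply, this, smul_zero]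

/-- The operator `H(x/y) = ∑_{n > 0} (p_n(x/y) / n) a_n` on the Fock space. -/
def opH : Module.End K (Fock K) :=
  locSum (fun n : ℕ => (powerSum x y (n + 1) / ((n : K) + 1)) • heis ((n : ℤ) + 1))
    (opH_finite x y)

theorem opH_energy (d : ℤ) {v : Fock K} (hv : v ∈ energyLE d) :
    opH x y v ∈ energyLE (d - 1) := by
  apply locSum_mem
  intro n
  rw [LinearMap.smul_apply]
  apply Submodule.smul_mem
  exact energyLE_mono (by omega) (heis_energy (show (0 : ℤ) < (n : ℤ) + 1 by omega) d hv)

theorem opH_locNilpotent : LocNilpotent (opH x y) := by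
  intro v
  obtain ⟨d, hd⟩ := exists_energyLE v
  have key : ∀ n : ℕ, (opH x y ^ n) v ∈ energyLE ((d : ℤ) - n) := by
    intro n
    induction n with
    | zero => simpa using hd
    | succ n ih =>
      rw [pow_succ', Module.End.mul_apply]
      exact energyLE_mono (by push_cast; omega) (opH_energy x y _ ih)
  refine ⟨d + 1, ?_⟩
  have := key (d + 1)
  rwa [energyLE_neg (by push_cast; omega), Submodule.mem_bot] at this

/-- The operator `e^{H(x/y)}`. -/
def expH : Module.End K (Fock K) := locExp (opH x y) (opH_locNilpotent x y)

/-- The operator `e^{-H(x/y)}`. -/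
def expNegH : Module.End K (Fock K) := locExp (-opH x y) (opH_locNilpotent x y).neg

end Super

/-- The fermionic expression
`S_λ(x/y) = ⟨0| ∏_{i=1}^{r} (e^{H(x⁽ⁱ⁾/y⁽ⁱ⁾)} ψ_{λ_i - i} e^{-H(x⁽ⁱ⁾/y⁽ⁱ⁾)}) |-r⟩`,
with the factors in the order `i = 1, …, r` from left to right.  The index `i : Fin r` of the code
is the index `i + 1` of the formula. -/
def fermionicS {r : ℕ} (lam : Fin r → ℕ) {M N : Fin r → ℕ}
    (x : ∀ i, Fin (M i) → K) (y : ∀ i, Fin (N i) → K) : K :=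
  bra0 ((List.ofFn fun i : Fin r => (expH (x i) (y i) * psi ((lam i : ℤ) - ((i : ℤ) + 1)) *
    expNegH (x i) (y i) : Module.End K (Fock K))).prod (shiftedVac (-(r : ℤ))))

end MultiSchur

end

/-!
The proof computes the conjugated fermions explicitly and then evaluates the vacuum expectation
value in the exterior algebra.

Write `ψ_m[f] = ∑_n f_n ψ_{m-n}` for a power series `f` (`psiSeries`). From `[a_k, ψ_j] = ψ_{j-k}`
(`heis_psi`) it follows that `[H, ψ_m[f]] = ψ_m[L f]` with `L = ∑_{n > 0} (p_n / n) zⁿ`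
(`opH_psiSeries`), so that conjugation by `e^H` multiplies the weight `f` by `exp L`
(`expH_psiSeries`, `expH_psi_expNegH`). The series `exp L` is the generating function of the `h_n`:
both have constant term `1` and logarithmic derivative `∑ p_{n+1} zⁿ`
(`expSeries_eq_completeSeries`). All infinite sums are handled on a fixed vector, of energy at most
`d` say, where they agree with truncations at any large enough bound.

In the exterior algebra, `ψ_m[f]` is the sum of the exterior multiplication by a vector supported on
the `e_j` with `0 ≤ j` and of the contraction with a functional supported on the `e_j` with `j < 0`
(`psiSeries_eq_mulLeft_add_contractLeft`). Hence the creation part of each factor anticommutes with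
the annihilation parts of all the others and, moved to the left, is killed by `⟨0|`
(`algebraMapInv_prod_mulLeft_add_contract`). What remains are `r` contractions of the decomposable
vector `|-r⟩ = e_{-r} ∧ ⋯ ∧ e_{-1}`, whose scalar part is a determinant by Laplace expansion
(`algebraMapInv_prod_contract_prod_ι`), with entries `h_{λ_i - i + j}`.
-/

noncomputable section

namespace MultiSchur

open PowerSeries

variable {K : Type*} [Field K]

/-! ### Finite truncations of locally finite sums -/

section Operators

variable {V : Type*} [AddCommGroup V] [Module K V]

theorem locSum_eq_sum_range (T : ℕ → Module.End K V) (hT : ∀ v, {i | T i v ≠ 0}.Finite) {v : V}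
    {B : ℕ} (h : ∀ n, B ≤ n → T n v = 0) : locSum T hT v = ∑ n ∈ Finset.range B, T n v :=
  finsum_eq_sum_of_support_subset _ fun n hn => by
    simpa using lt_of_not_ge fun hB => hn (h n hB)

theorem pow_apply_eq_zero_of_le {T : Module.End K V} {v : V} {m n : ℕ} (h : (T ^ m) v = 0)
    (hmn : m ≤ n) : (T ^ n) v = 0 := by
  rw [← Nat.sub_add_cancel hmn, pow_add, Module.End.mul_apply, h, map_zero]

theorem locExp_eq_sum_range {T : Module.End K V} (hT : LocNilpotent T) {v : V} {B : ℕ}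
    (h : (T ^ B) v = 0) :
    locExp T hT v = ∑ n ∈ Finset.range B, (n.factorial : K)⁻¹ • (T ^ n) v :=
  locSum_eq_sum_range _ _ fun n hn => by
    rw [LinearMap.smul_apply, pow_apply_eq_zero_of_le h hn, smul_zero]

/-- A double sum vanishing outside the square `[0, B)²` may be summed along antidiagonals. -/
theorem sum_square_eq_sum_antidiagonal (F : ℕ → ℕ → V) (B : ℕ)
    (hF : ∀ i j, B ≤ i ∨ B ≤ j → F i j = 0) :
    ∑ i ∈ Finset.range B, ∑ j ∈ Finset.range B, F i j =
      ∑ n ∈ Finset.range (2 * B), ∑ p ∈ Finset.HasAntidiagonal.antidiagonal n, F p.1 p.2 := by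
  rw [← Finset.sum_product',
    ← Finset.sum_fiberwise_of_maps_to (t := Finset.range (2 * B)) (g := fun p => p.1 + p.2)]
  · refine Finset.sum_congr rfl fun n _ => Finset.sum_subset ?_ ?_
    · intro p hp
      simp only [Finset.mem_filter] at hp
      simpa using hp.2
    · intro p hp hp'
      apply hF
      simp only [Finset.mem_filter, Finset.mem_product, Finset.mem_range,
        Finset.HasAntidiagonal.mem_antidiagonal] at hp hp'
      omega
  · intro p hp
    simp only [Finset.mem_product, Finset.mem_range] at hp ⊢
    omega

theorem inv_factorial_mul_choose [CharZero K] {n : ℕ} {p : ℕ × ℕ}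
    (hp : p ∈ Finset.HasAntidiagonal.antidiagonal n) :
    (n.factorial : K)⁻¹ * (n.choose p.1 : K) =
      (p.1.factorial : K)⁻¹ * (p.2.factorial : K)⁻¹ := by
  obtain rfl := Finset.HasAntidiagonal.mem_antidiagonal.1 hp
  have h := Nat.add_choose_mul_factorial_mul_factorial p.1 p.2
  rw [← Nat.choose_symm_add] at h
  have h' : ((p.1 + p.2).choose p.1 : K) * p.1.factorial * p.2.factorial =
      (p.1 + p.2).factorial := by exact_mod_cast h
  have h0 : ((p.1 + p.2).factorial : K) ≠ 0 := by exact_mod_cast Nat.factorial_ne_zero _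
  have h1 : (p.1.factorial : K) ≠ 0 := by exact_mod_cast Nat.factorial_ne_zero _
  have h2 : (p.2.factorial : K) ≠ 0 := by exact_mod_cast Nat.factorial_ne_zero _
  field_simp
  linear_combination h'

theorem locExp_mul_locExp_neg [CharZero K] {T : Module.End K V} (hT : LocNilpotent T) :
    locExp T hT * locExp (-T) hT.neg = 1 := by
  refine LinearMap.ext fun v => ?_
  obtain ⟨B, hB⟩ := hT v
  have hneg : ((-T) ^ B) v = 0 := by
    rcases Nat.even_or_odd B with h | h
    · rw [h.neg_pow, hB]
    · rw [h.neg_pow, LinearMap.neg_apply, hB, neg_zero]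
  have hcomm : Commute T (-T) := (Commute.refl T).neg_right
  have hkill : ∀ j : ℕ, (T ^ B) (((-T) ^ j) v) = 0 := fun j => by
    rw [← Module.End.mul_apply, (hcomm.pow_pow B j).eq, Module.End.mul_apply, hB, map_zero]
  rw [Module.End.mul_apply, locExp_eq_sum_range hT.neg hneg, map_sum]
  have h1 : ∀ j, locExp T hT (((j.factorial : K)⁻¹) • ((-T) ^ j) v) =
      ∑ i ∈ Finset.range B,
        ((i.factorial : K)⁻¹ * (j.factorial : K)⁻¹) • (T ^ i) (((-T) ^ j) v) := fun j => by
    rw [map_smul, locExp_eq_sum_range hT (hkill j), Finset.smul_sum]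
    exact Finset.sum_congr rfl fun i _ => by rw [smul_smul, mul_comm]
  simp only [h1]
  rw [Finset.sum_comm, sum_square_eq_sum_antidiagonal (fun i j =>
    ((i.factorial : K)⁻¹ * (j.factorial : K)⁻¹) • (T ^ i) (((-T) ^ j) v)) B]
  · have h2 : ∀ n, ∑ p ∈ Finset.HasAntidiagonal.antidiagonal n,
        ((p.1.factorial : K)⁻¹ * (p.2.factorial : K)⁻¹) • (T ^ p.1) (((-T) ^ p.2) v) =
          (n.factorial : K)⁻¹ • ((T + -T) ^ n) v := fun n => by
      rw [hcomm.add_pow', LinearMap.sum_apply, Finset.smul_sum]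
      refine Finset.sum_congr rfl fun p hp => ?_
      rw [LinearMap.smul_apply, ← Nat.cast_smul_eq_nsmul K, smul_smul,
        inv_factorial_mul_choose hp, Module.End.mul_apply]
    simp only [h2, add_neg_cancel, Module.End.one_apply]
    by_cases hB0 : B = 0
    · subst hB0
      simpa using hB.symm
    · rw [Finset.sum_eq_single_of_mem 0 (by simp; omega)]
      · simp
      · intro n _ hn
        simp [zero_pow hn]
  · rintro i j (h | h)
    · rw [pow_apply_eq_zero_of_le (hkill j) h, smul_zero]
    · rw [pow_apply_eq_zero_of_le hneg h, map_zero, smul_zero]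

end Operators

/-! ### Fermion fields weighted by a power series -/

theorem psiSeries_finite (m : ℤ) (f : K⟦X⟧) (v : Fock K) :
    {n : ℕ | (coeff n f • psi (m - n)) v ≠ 0}.Finite := by
  obtain ⟨d, hd⟩ := exists_energyLE v
  refine (Set.finite_lt_nat (m + d + 1).toNat).subset fun n hn => ?_
  by_contra h
  apply hn
  simp only [Set.mem_ofPred_eq] at h
  rw [LinearMap.smul_apply, psi_eq_zero (d := d) (by omega) hd, smul_zero]

/-- The operator `∑_{n ≥ 0} f_n ψ_{m-n}`, as a linear function of the power series
`f = ∑ f_n zⁿ`: the coefficient of `z^m` in `f(z) ψ(z)`, where `ψ(z) = ∑ ψ_n zⁿ`. -/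
def psiSeries (m : ℤ) : K⟦X⟧ →ₗ[K] Module.End K (Fock K) where
  toFun f := locSum (fun n : ℕ => coeff n f • psi (m - n)) (psiSeries_finite m f)
  map_add' f g := by
    refine LinearMap.ext fun v => ?_
    refine Eq.trans ?_ (finsum_add_distrib (psiSeries_finite m f v) (psiSeries_finite m g v))
    exact finsum_congr fun n => by simp [add_smul]
  map_smul' c f := by
    refine LinearMap.ext fun v => ?_
    refine Eq.trans ?_ (smul_finsum' c (psiSeries_finite m f v)).symm
    exact finsum_congr fun n => by simp [mul_smul]

theorem psiSeries_apply_eq_sum {m d : ℤ} {B : ℕ} (hB : m + d < B) (f : K⟦X⟧) {v : Fock K}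
    (hv : v ∈ energyLE d) :
    psiSeries m f v = ∑ n ∈ Finset.range B, coeff n f • psi (m - n) v :=
  locSum_eq_sum_range _ (psiSeries_finite m f) fun n hn => by
    rw [LinearMap.smul_apply, psi_eq_zero (d := d) (by omega) hv, smul_zero]

theorem psiSeries_one (m : ℤ) : psiSeries m (1 : K⟦X⟧) = psi m := by
  refine LinearMap.ext fun v => ?_
  refine (finsum_eq_single _ 0 fun n hn => ?_).trans (by simp)
  simp [coeff_one, hn]

theorem psiSeries_energy (m d : ℤ) (f : K⟦X⟧) {v : Fock K} (hv : v ∈ energyLE d) :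
    psiSeries m f v ∈ energyLE (d + m) :=
  locSum_mem _ (psiSeries_finite m f) _ _ fun n =>
    Submodule.smul_mem _ _ (energyLE_mono (by omega) (psi_energy (m - n) d hv))

theorem psiSeries_eq_zero {m d : ℤ} (h : d + m < 0) (f : K⟦X⟧) {v : Fock K}
    (hv : v ∈ energyLE d) : psiSeries m f v = 0 := by
  simpa [energyLE_neg h] using psiSeries_energy m d f hv

theorem psiSeries_X_pow_mul (m : ℤ) (k : ℕ) (f : K⟦X⟧) :
    psiSeries m (X ^ k * f) = psiSeries (m - k) f := by
  refine LinearMap.ext fun v => ?_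
  obtain ⟨d, hd⟩ := exists_energyLE v
  obtain ⟨B, hB⟩ : ∃ B : ℕ, m + d < B := ⟨(m + d + 1).toNat, by omega⟩
  rw [psiSeries_apply_eq_sum (B := k + B) (by push_cast; omega) _ hd,
    psiSeries_apply_eq_sum (B := B) (by omega) _ hd, Finset.sum_range_add,
    Finset.sum_eq_zero, zero_add]
  · refine Finset.sum_congr rfl fun n _ => ?_
    rw [add_comm k n, coeff_X_pow_mul]
    congr 3
    push_cast
    ring
  · intro n hn
    rw [coeff_X_pow_mul', if_neg (by simpa using hn), zero_smul]

theorem psiSeries_eq_zero_of_X_pow_dvd {m d : ℤ} {B : ℕ} (hB : m + d < B) {f : K⟦X⟧}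
    (hf : X ^ B ∣ f) {v : Fock K} (hv : v ∈ energyLE d) : psiSeries m f v = 0 := by
  obtain ⟨g, rfl⟩ := hf
  rw [psiSeries_X_pow_mul, psiSeries_eq_zero (d := d) (by omega) _ hv]

/-! ### Commutators of the Heisenberg operators with the fermions -/

theorem heis_psi {k : ℤ} (hk : 0 < k) (j : ℤ) (v : Fock K) :
    heis k (psi j v) = psi j (heis k v) + psi (j - k) v := by
  have key : ∀ i : ℤ, normalOrder i (i + k) (psi j v) =
      psi j (normalOrder i (i + k) v) + if i = j - k then psi i v else 0 := fun i => by
    have h1 := LinearMap.congr_fun (psi_psiStar (K := K) j (i + k)) v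
    have h2 := LinearMap.congr_fun (psi_psi (K := K) i j) (psiStar (i + k) v)
    simp only [LinearMap.add_apply, Module.End.mul_apply, LinearMap.zero_apply] at h1 h2
    rw [normalOrder, vev_psi_psiStar, if_neg (by omega), zero_smul, sub_zero,
      Module.End.mul_apply, Module.End.mul_apply, eq_sub_of_add_eq' h1, map_sub,
      eq_neg_of_add_eq_zero_left h2]
    by_cases h : i = j - k
    · rw [if_pos h, if_pos (by omega), Module.End.one_apply]
      abel
    · rw [if_neg h, if_neg (by omega), LinearMap.zero_apply, map_zero]
      abel
  have hfin := normalOrder_finite k v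
  have e1 : heis k (psi j v) = ∑ᶠ i : ℤ,
      (psi j (normalOrder i (i + k) v) + if i = j - k then psi i v else 0) :=
    finsum_congr key
  have e2 : psi j (heis k v) = ∑ᶠ i : ℤ, psi j (normalOrder i (i + k) v) :=
    (psi j).toAddMonoidHom.map_finsum hfin
  rw [e1, e2, finsum_add_distrib]
  · congr 1
    refine (finsum_eq_single _ (j - k) fun i hi => if_neg hi).trans (if_pos rfl)
  · refine hfin.subset fun i hi h0 => hi ?_
    simp only [h0, map_zero]
  · refine (Set.finite_singleton (j - k)).subset fun i hi => ?_
    by_contra h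
    exact hi (if_neg h)

section Super

variable {M N : ℕ} (x : Fin M → K) (y : Fin N → K)

/-- The power series `∑_{n > 0} (p_n(x/y) / n) zⁿ`, the logarithm of the generating function of
the `h_n(x/y)`. -/
def logSeries : K⟦X⟧ := X * PowerSeries.mk fun n => powerSum x y (n + 1) / ((n : K) + 1)

theorem opH_psi (m : ℤ) (v : Fock K) :
    opH x y (psi m v) = psi m (opH x y v) + psiSeries m (logSeries x y) v := by
  have hfin := opH_finite x y v
  have h1 : psiSeries m (logSeries x y) v = ∑ᶠ n : ℕ,
      (powerSum x y (n + 1) / ((n : K) + 1)) • psi (m - (n + 1)) v := by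
    have := psiSeries_X_pow_mul m 1
      (PowerSeries.mk fun n => powerSum x y (n + 1) / ((n : K) + 1))
    rw [pow_one] at this
    rw [logSeries, this]
    refine finsum_congr fun n => ?_
    rw [LinearMap.smul_apply, coeff_mk]
    congr 3
    push_cast
    ring
  have h2 : psi m (opH x y v) = ∑ᶠ n : ℕ,
      (powerSum x y (n + 1) / ((n : K) + 1)) • psi m (heis (n + 1) v) :=
    ((psi m).toAddMonoidHom.map_finsum hfin).trans (finsum_congr fun n => (psi m).map_smul _ _)
  rw [h1, h2, ← finsum_add_distrib]
  · refine finsum_congr fun n => ?_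
    rw [LinearMap.smul_apply, heis_psi (by omega), smul_add]
  · refine hfin.subset fun n hn h0 => hn ?_
    simp only [LinearMap.smul_apply] at h0
    exact ((psi m).map_smul _ _).symm.trans ((congrArg (psi m) h0).trans (map_zero _))
  · obtain ⟨d, hd⟩ := exists_energyLE v
    refine (Set.finite_lt_nat (m + d + 1).toNat).subset fun n hn => ?_
    by_contra h
    simp only [Set.mem_ofPred_eq] at h
    apply hn
    simp only [psi_eq_zero (show (d : ℤ) + (m - (n + 1)) < 0 by omega) hd, smul_zero]

/-- The commutator with `H(x/y)` multiplies the weight `f` of a fermion field by the logarithm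
of the generating function of the `h_n(x/y)`. -/
theorem opH_psiSeries (m : ℤ) (f : K⟦X⟧) (v : Fock K) :
    opH x y (psiSeries m f v) =
      psiSeries m (logSeries x y * f) v + psiSeries m f (opH x y v) := by
  obtain ⟨d, hd⟩ := exists_energyLE v
  obtain ⟨B, hB⟩ : ∃ B : ℕ, m + d < B := ⟨(m + d + 1).toNat, by omega⟩
  have hHv : opH x y v ∈ energyLE (d : ℤ) := energyLE_mono (by omega) (opH_energy x y d hd)
  -- Multiples of `X ^ B` act by zero on `v`, so `f` may be replaced by its truncation at `X ^ B`.
  have hdvd : X ^ B ∣ logSeries x y * f -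
      ∑ n ∈ Finset.range B, coeff n f • (X ^ n * logSeries x y) := by
    have h : ∑ n ∈ Finset.range B, coeff n f • (X ^ n * logSeries x y) =
        logSeries x y * ∑ n ∈ Finset.range B, coeff n f • X ^ n := by
      rw [Finset.mul_sum]
      exact Finset.sum_congr rfl fun n _ => by rw [mul_smul_comm, mul_comm]
    rw [h, ← mul_sub]
    refine Dvd.dvd.mul_left (X_pow_dvd_iff.2 fun n hn => ?_) _
    simp [coeff_X_pow, hn]
  have h0 := psiSeries_eq_zero_of_X_pow_dvd hB hdvd hd
  rw [map_sub, LinearMap.sub_apply, sub_eq_zero] at h0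
  rw [h0, psiSeries_apply_eq_sum hB f hd, psiSeries_apply_eq_sum hB f hHv]
  simp only [map_sum, map_smul, psiSeries_X_pow_mul, opH_psi, LinearMap.sum_apply,
    LinearMap.smul_apply, smul_add, Finset.sum_add_distrib]
  rw [add_comm]

theorem opH_pow_energy (n : ℕ) (d : ℤ) {v : Fock K} (hv : v ∈ energyLE d) :
    (opH x y ^ n) v ∈ energyLE (d - n) := by
  induction n with
  | zero => simpa using hv
  | succ n ih =>
    rw [pow_succ', Module.End.mul_apply]
    exact energyLE_mono (by push_cast; omega) (opH_energy x y _ ih)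

theorem opH_pow_eq_zero {n : ℕ} {d : ℤ} (h : d < n) {v : Fock K} (hv : v ∈ energyLE d) :
    (opH x y ^ n) v = 0 := by
  simpa [energyLE_neg (sub_neg.2 h)] using opH_pow_energy x y n d hv

/-- The Leibniz rule for iterated commutators with `H(x/y)`. -/
theorem opH_pow_psiSeries (m : ℤ) (n : ℕ) (f : K⟦X⟧) (v : Fock K) :
    (opH x y ^ n) (psiSeries m f v) = ∑ p ∈ Finset.HasAntidiagonal.antidiagonal n,
      n.choose p.1 • psiSeries m (logSeries x y ^ p.1 * f) ((opH x y ^ p.2) v) := by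
  -- The action `f ⊗ v ↦ psiSeries m f v` intertwines `H` with a sum of two commuting operators.
  let μ : TensorProduct K K⟦X⟧ (Fock K) →ₗ[K] Fock K := TensorProduct.lift (psiSeries m)
  let a : Module.End K (TensorProduct K K⟦X⟧ (Fock K)) :=
    LinearMap.rTensor (Fock K) (LinearMap.mulLeft K (logSeries x y))
  let b : Module.End K (TensorProduct K K⟦X⟧ (Fock K)) := LinearMap.lTensor K⟦X⟧ (opH x y)
  have hab : Commute a b := TensorProduct.ext' fun g w => by simp [a, b]
  have hμ : ∀ t, opH x y (μ t) = μ ((a + b) t) := fun t => by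
    induction t with
    | zero => simp
    | add s t hs ht => simp only [map_add, hs, ht]
    | tmul g w => simp [μ, a, b, opH_psiSeries]
  have hpow : ∀ t, (opH x y ^ n) (μ t) = μ (((a + b) ^ n) t) := by
    induction n with
    | zero => simp
    | succ n ih =>
      intro t
      rw [pow_succ, Module.End.mul_apply, hμ, ih, pow_succ, Module.End.mul_apply]
  have := hpow (f ⊗ₜ v)
  rw [hab.add_pow', LinearMap.sum_apply, map_sum] at this
  refine this.trans (Finset.sum_congr rfl fun p _ => ?_)
  simp only [LinearMap.smul_apply, map_nsmul, Module.End.mul_apply, a, b,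
    LinearMap.rTensor_pow, LinearMap.lTensor_pow, LinearMap.lTensor_tmul,
    LinearMap.rTensor_tmul, LinearMap.pow_mulLeft, LinearMap.mulLeft_apply]
  rfl

end Super

/-! ### Conjugation of the fermions by the exponential -/

section Conjugation

variable [CharZero K] {M N : ℕ} (x : Fin M → K) (y : Fin N → K)

/-- The exponential of `logSeries x y`. -/
def expSeries : K⟦X⟧ := (exp K).subst (logSeries x y)

theorem hasSubst_logSeries : HasSubst (logSeries x y) :=
  HasSubst.of_constantCoeff_zero' (by simp [logSeries])

theorem X_pow_dvd_expSeries_sub (B : ℕ) :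
    X ^ B ∣ expSeries x y -
      ∑ i ∈ Finset.range B, (i.factorial : K)⁻¹ • logSeries x y ^ i := by
  refine X_pow_dvd_iff.2 fun n hn => ?_
  rw [map_sub, sub_eq_zero, expSeries, coeff_subst' (hasSubst_logSeries x y), map_sum,
    finsum_eq_sum_of_support_subset (s := Finset.range B)]
  · refine Finset.sum_congr rfl fun i _ => ?_
    simp [coeff_exp]
  · intro i hi
    simp only [Finset.coe_range, Set.mem_Iio]
    by_contra h
    apply hi
    simp only
    rw [logSeries, mul_pow, coeff_X_pow_mul', if_neg (by omega), smul_zero]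

theorem psiSeries_expSeries_mul {m d : ℤ} {B : ℕ} (hB : m + d < B) (f : K⟦X⟧) {v : Fock K}
    (hv : v ∈ energyLE d) :
    psiSeries m (expSeries x y * f) v = ∑ i ∈ Finset.range B,
      (i.factorial : K)⁻¹ • psiSeries m (logSeries x y ^ i * f) v := by
  have h := psiSeries_eq_zero_of_X_pow_dvd hB
    ((X_pow_dvd_expSeries_sub x y B).mul_right f) hv
  rw [sub_mul, Finset.sum_mul, map_sub, LinearMap.sub_apply, sub_eq_zero] at h
  rw [h]
  simp only [smul_mul_assoc, map_sum, map_smul, LinearMap.sum_apply, LinearMap.smul_apply]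

/-- The relation `e^H ψ_m[f] = ψ_m[exp(L) f] e^H`, by comparing the expansion of the left side along
antidiagonals, given by the Leibniz rule, with the product of the two exponential series. -/
theorem expH_psiSeries (m : ℤ) (f : K⟦X⟧) (v : Fock K) :
    expH x y (psiSeries m f v) = psiSeries m (expSeries x y * f) (expH x y v) := by
  obtain ⟨d, hd⟩ := exists_energyLE v
  obtain ⟨B, hB, hB'⟩ : ∃ B : ℕ, m + d < B ∧ (d : ℤ) < B :=
    ⟨(m + d + 1).toNat + d + 1, by omega, by omega⟩
  have hΨ := psiSeries_energy m d f hd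
  have hpow : ∀ j : ℕ, (opH x y ^ j) v ∈ energyLE (d : ℤ) := fun j =>
    energyLE_mono (by omega) (opH_pow_energy x y j d hd)
  have hR : psiSeries m (expSeries x y * f) (expH x y v) =
      ∑ i ∈ Finset.range B, ∑ j ∈ Finset.range B,
        ((i.factorial : K)⁻¹ * (j.factorial : K)⁻¹) •
          psiSeries m (logSeries x y ^ i * f) ((opH x y ^ j) v) := by
    rw [expH, locExp_eq_sum_range _ (opH_pow_eq_zero x y hB' hd), map_sum, Finset.sum_comm]
    refine Finset.sum_congr rfl fun j _ => ?_
    rw [map_smul, psiSeries_expSeries_mul x y hB f (hpow j), Finset.smul_sum]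
    exact Finset.sum_congr rfl fun i _ => by rw [smul_smul, mul_comm]
  rw [hR, sum_square_eq_sum_antidiagonal (fun i j =>
    ((i.factorial : K)⁻¹ * (j.factorial : K)⁻¹) •
      psiSeries m (logSeries x y ^ i * f) ((opH x y ^ j) v)) B, expH,
    locExp_eq_sum_range _ (opH_pow_eq_zero x y (n := 2 * B) (by push_cast; omega) hΨ)]
  · refine Finset.sum_congr rfl fun n _ => ?_
    rw [opH_pow_psiSeries, Finset.smul_sum]
    refine Finset.sum_congr rfl fun p hp => ?_
    rw [← Nat.cast_smul_eq_nsmul K, smul_smul, inv_factorial_mul_choose hp]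
  · rintro i j (h | h)
    · rw [logSeries, mul_pow, mul_assoc, psiSeries_X_pow_mul,
        psiSeries_eq_zero (d := d) (by omega) _ (hpow j), smul_zero]
    · rw [opH_pow_eq_zero x y (n := j) (by omega) hd, map_zero, smul_zero]

/-- `e^H ψ_m e^{-H} = ∑_n E_n ψ_{m-n}`, where `E = ∑ E_n zⁿ` is `expSeries x y`. -/
theorem expH_psi_expNegH (m : ℤ) :
    expH x y * psi m * expNegH x y = psiSeries m (expSeries x y) := by
  refine LinearMap.ext fun v => ?_
  have h := LinearMap.congr_fun (locExp_mul_locExp_neg (opH_locNilpotent x y)) v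
  rw [Module.End.mul_apply, Module.End.one_apply] at h
  rw [Module.End.mul_apply, Module.End.mul_apply, ← psiSeries_one, expH_psiSeries, mul_one]
  exact congrArg _ h

end Conjugation

/-! ### The generating function of the `h_n(x/y)` -/

section GeneratingFunction

variable {M N : ℕ} (x : Fin M → K) (y : Fin N → K)

/-- The generating function `∑ h_n(x/y) zⁿ`. -/
def completeSeries : K⟦X⟧ := (∏ j, (1 - C (x j) * X)⁻¹) * ∏ l, (1 - C (y l) * X)

theorem complete_eq_coeff (n : ℤ) :
    complete x y n = if 0 ≤ n then coeff n.toNat (completeSeries x y) else 0 := rfl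

theorem constantCoeff_completeSeries : constantCoeff (completeSeries x y) = 1 := by
  simp [completeSeries, map_prod]

theorem derivative_prod_of_logDeriv {ι : Type*} (s : Finset ι) (f a : ι → K⟦X⟧)
    (h : ∀ i ∈ s, d⁄dX K (f i) = a i * f i) :
    d⁄dX K (∏ i ∈ s, f i) = (∑ i ∈ s, a i) * ∏ i ∈ s, f i := by
  classical
  induction s using Finset.induction_on with
  | empty => simp
  | insert i s hi ih =>
    rw [Finset.prod_insert hi, Finset.sum_insert hi, Derivation.leibniz,
      ih fun j hj => h j (Finset.mem_insert_of_mem hj), h i (Finset.mem_insert_self i s)]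
    simp only [smul_eq_mul]
    ring

theorem mk_pow_succ_mul_one_sub (c : K) :
    (PowerSeries.mk fun n => c ^ (n + 1)) * (1 - C c * X) = C c := by
  ext n
  rw [mul_sub, mul_one, map_sub, mul_left_comm, coeff_C_mul, coeff_mk, coeff_C]
  cases n with
  | zero => simp
  | succ n =>
    rw [coeff_succ_mul_X, coeff_mk, if_neg (by omega)]
    ring

theorem derivative_one_sub_C_mul_X (c : K) :
    d⁄dX K (1 - C c * X) = -(PowerSeries.mk fun n => c ^ (n + 1)) * (1 - C c * X) := by
  rw [neg_mul, mk_pow_succ_mul_one_sub, map_sub, derivative_one, Derivation.leibniz,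
    derivative_C, derivative_X, smul_zero, add_zero, zero_sub, smul_eq_mul, mul_one]

theorem derivative_inv_one_sub_C_mul_X (c : K) :
    d⁄dX K (1 - C c * X)⁻¹ = (PowerSeries.mk fun n => c ^ (n + 1)) * (1 - C c * X)⁻¹ := by
  have h : (1 - C c * X)⁻¹ * (1 - C c * X) = 1 := PowerSeries.inv_mul_cancel _ (by simp)
  rw [derivative_inv', derivative_one_sub_C_mul_X]
  linear_combination ((PowerSeries.mk fun n => c ^ (n + 1)) * (1 - C c * X)⁻¹) * h

theorem derivative_completeSeries : d⁄dX K (completeSeries x y) =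
    (PowerSeries.mk fun n => powerSum x y (n + 1)) * completeSeries x y := by
  have h : (PowerSeries.mk fun n => powerSum x y (n + 1)) =
      (∑ j, PowerSeries.mk fun n => x j ^ (n + 1)) +
        ∑ l, -(PowerSeries.mk fun n => y l ^ (n + 1)) := by
    ext n
    simp [powerSum, sub_eq_add_neg]
  rw [completeSeries, Derivation.leibniz,
    derivative_prod_of_logDeriv _ _ _ fun j _ => derivative_inv_one_sub_C_mul_X (x j),
    derivative_prod_of_logDeriv _ _ _ fun l _ => derivative_one_sub_C_mul_X (y l), h]
  simp only [smul_eq_mul]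
  ring

variable [CharZero K]

theorem derivative_logSeries :
    d⁄dX K (logSeries x y) = PowerSeries.mk fun n => powerSum x y (n + 1) := by
  ext n
  have : (n : K) + 1 ≠ 0 := by exact_mod_cast n.succ_ne_zero
  rw [coeff_derivative, logSeries, coeff_succ_X_mul, coeff_mk, coeff_mk]
  field_simp

/-- Both sides have constant term `1` and the same logarithmic derivative. -/
theorem expSeries_eq_completeSeries : expSeries x y = completeSeries x y := by
  have hc : constantCoeff (completeSeries x y) ≠ 0 := by
    simp [constantCoeff_completeSeries]
  have hE : d⁄dX K (expSeries x y) =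
      (PowerSeries.mk fun n => powerSum x y (n + 1)) * expSeries x y := by
    rw [expSeries, derivative_subst (hasSubst_logSeries x y), derivative_exp,
      derivative_logSeries, mul_comm]
  have hE0 : constantCoeff (expSeries x y) = 1 := by
    have := X_pow_dvd_iff.1 (X_pow_dvd_expSeries_sub x y 1) 0 one_pos
    simpa [sub_eq_zero] using this
  suffices h : expSeries x y * (completeSeries x y)⁻¹ = 1 by
    rw [← mul_one (expSeries x y), ← PowerSeries.inv_mul_cancel _ hc, ← mul_assoc, h, one_mul]
  have hinv := PowerSeries.inv_mul_cancel _ hc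
  refine derivative.ext ?_ ?_
  · rw [Derivation.leibniz, derivative_inv', hE, derivative_completeSeries, derivative_one]
    simp only [smul_eq_mul]
    linear_combination (-(PowerSeries.mk fun n => powerSum x y (n + 1)) * expSeries x y *
      (completeSeries x y)⁻¹) * hinv
  · simp [hE0, constantCoeff_completeSeries]

end GeneratingFunction

/-! ### Weighted fermion fields as a creation plus a contraction -/

/-- Contraction of a vector of energy at most `d` only involves the values of the functional on the
`e_j` with `|j| ≤ d`. -/
theorem contractLeft_eq_zero {d : ℤ} {φ : (ℤ →₀ K) →ₗ[K] K}
    (hφ : ∀ j : ℤ, |j| ≤ d → φ (Finsupp.single j 1) = 0) {v : Fock K} (hv : v ∈ energyLE d) :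
    CliffordAlgebra.contractLeft (Q := (0 : QuadraticForm K (ℤ →₀ K))) φ v = 0 := by
  induction hv using Submodule.span_induction with
  | mem v hv =>
    obtain ⟨l, hl, rfl⟩ := hv
    induction l generalizing d with
    | nil => exact CliffordAlgebra.contractLeft_one (Q := (0 : QuadraticForm K (ℤ →₀ K))) _
    | cons a l ih =>
      simp only [List.map_cons, List.sum_cons] at hl
      have hnn : 0 ≤ (l.map abs).sum := List.sum_nonneg fun b hb => by
        obtain ⟨c, -, rfl⟩ := List.mem_map.1 hb
        exact abs_nonneg c
      have h0 := abs_nonneg a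
      rw [List.map_cons, List.prod_cons, Module.End.mul_apply]
      nth_rw 1 [create]
      rw [LinearMap.mulLeft_apply, ExteriorAlgebra.ι, CliffordAlgebra.contractLeft_ι_mul,
        hφ a (by omega), ih (d := d) hφ (by omega), zero_smul, mul_zero, sub_zero]
  | zero => simp
  | add v w _ _ hv hw => rw [map_add, hv, hw, add_zero]
  | smul c v _ hv => rw [map_smul, hv, smul_zero]

/-- The functional `e_j ↦ f_{m-j}` on the span of the `e_j` with `j < 0`, extended by `0` to the
`e_j` with `0 ≤ j`.  Contraction with it is the annihilation part of `psiSeries m f`. -/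
def negPart (m : ℤ) (f : K⟦X⟧) : (ℤ →₀ K) →ₗ[K] K :=
  Finsupp.linearCombination K fun j : ℤ =>
    if j < 0 ∧ j ≤ m then coeff (m - j).toNat f else 0

/-- The vector `∑_{0 ≤ j ≤ m} f_{m-j} e_j`, whose exterior multiplication is the creation part of
`psiSeries m f`. -/
def posPart (m : ℤ) (f : K⟦X⟧) : ℤ →₀ K :=
  ∑ n ∈ Finset.range (m + 1).toNat, coeff n f • Finsupp.single (m - n) 1

theorem negPart_single (m j : ℤ) (f : K⟦X⟧) : negPart m f (Finsupp.single j 1) =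
    if j < 0 ∧ j ≤ m then coeff (m - j).toNat f else 0 := by
  simp [negPart]

theorem negPart_posPart (m m' : ℤ) (f g : K⟦X⟧) : negPart m f (posPart m' g) = 0 := by
  rw [posPart, map_sum]
  refine Finset.sum_eq_zero fun n hn => ?_
  rw [Finset.mem_range] at hn
  rw [map_smul, negPart_single, if_neg (by omega), smul_zero]

theorem psiSeries_eq_mulLeft_add_contractLeft (m : ℤ) (f : K⟦X⟧) :
    psiSeries m f = LinearMap.mulLeft K (ExteriorAlgebra.ι K (posPart m f)) +
      CliffordAlgebra.contractLeft (Q := (0 : QuadraticForm K (ℤ →₀ K))) (negPart m f) := by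
  refine LinearMap.ext fun v => ?_
  obtain ⟨d, hd⟩ := exists_energyLE v
  set p := (m + 1).toNat with hp
  obtain ⟨q, hq⟩ : ∃ q : ℕ, m + d < q := ⟨(m + d + 1).toNat, by omega⟩
  rw [psiSeries_apply_eq_sum (B := p + q) (by push_cast; omega) f hd, Finset.sum_range_add,
    LinearMap.add_apply]
  congr 1
  · rw [LinearMap.mulLeft_apply, posPart, map_sum, Finset.sum_mul]
    refine Finset.sum_congr rfl fun n hn => ?_
    rw [Finset.mem_range] at hn
    rw [psi, if_pos (by omega), create, LinearMap.mulLeft_apply, map_smul, smul_mul_assoc]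
  -- The terms with `m < n` form a contraction with a finite sum of coordinate functionals, which
  -- agrees with `negPart m f` on all `e_j` with `|j| ≤ d`.
  · have h : ∑ n ∈ Finset.range q, coeff (p + n) f • psi (m - (p + n : ℕ)) v =
        CliffordAlgebra.contractLeft (Q := (0 : QuadraticForm K (ℤ →₀ K)))
          (∑ n ∈ Finset.range q, coeff (p + n) f •
            (Finsupp.lapply (m - (p + n : ℕ)) : (ℤ →₀ K) →ₗ[K] K)) v := by
      rw [map_sum, LinearMap.sum_apply]
      refine Finset.sum_congr rfl fun n _ => ?_
      rw [psi, if_neg (by omega), map_smul, LinearMap.smul_apply, annihilate]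
    rw [h, ← sub_eq_zero, ← LinearMap.sub_apply, ← map_sub]
    refine contractLeft_eq_zero (d := d) (fun j hj => ?_) hd
    rw [LinearMap.sub_apply, negPart_single, sub_eq_zero, LinearMap.sum_apply]
    simp only [LinearMap.smul_apply, Finsupp.lapply_apply, Finsupp.single_apply, smul_eq_mul,
      mul_ite, mul_one, mul_zero]
    have hj' := neg_le_of_abs_le hj
    split_ifs with hjm
    · rw [Finset.sum_eq_single (m - j - p).toNat]
      · rw [if_pos (by omega)]
        congr 2
        omega
      · intro n _ hn
        exact if_neg (by omega)
      · intro hn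
        rw [Finset.mem_range] at hn
        omega
    · exact Finset.sum_eq_zero fun n _ => if_neg (by omega)

/-! ### The vacuum expectation value as a determinant -/

section Wick

variable {E : Type*} [AddCommGroup E] [Module K E]

/-- Contraction with a linear functional, as an operator on the exterior algebra. -/
abbrev contract (φ : E →ₗ[K] K) : Module.End K (ExteriorAlgebra K E) :=
  CliffordAlgebra.contractLeft (Q := (0 : QuadraticForm K E)) φ

theorem contract_ι_mul (φ : E →ₗ[K] K) (u : E) (w : ExteriorAlgebra K E) :
    contract φ (ExteriorAlgebra.ι K u * w) =
      φ u • w - ExteriorAlgebra.ι K u * contract φ w :=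
  CliffordAlgebra.contractLeft_ι_mul (Q := (0 : QuadraticForm K E)) φ u w

theorem exists_prod_contract_ι_mul (l : List (E →ₗ[K] K)) (u : E) (h : ∀ φ ∈ l, φ u = 0)
    (w : ExteriorAlgebra K E) :
    ∃ w', (l.map contract).prod (ExteriorAlgebra.ι K u * w) = ExteriorAlgebra.ι K u * w' := by
  induction l with
  | nil => exact ⟨w, rfl⟩
  | cons φ l ih =>
    obtain ⟨w', hw'⟩ := ih fun ψ hψ => h ψ (List.mem_cons_of_mem _ hψ)
    refine ⟨-contract φ w', ?_⟩
    rw [List.map_cons, List.prod_cons, Module.End.mul_apply, hw', contract_ι_mul,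
      h φ List.mem_cons_self, zero_smul, zero_sub, mul_neg]

theorem algebraMapInv_ι_mul (u : E) (w : ExteriorAlgebra K E) :
    ExteriorAlgebra.algebraMapInv (ExteriorAlgebra.ι K u * w) = 0 := by
  simp [ExteriorAlgebra.algebraMapInv]

/-- Creation parts that anticommute with all contractions may be moved to the left, where the
scalar part kills them. -/
theorem algebraMapInv_prod_mulLeft_add_contract (l₁ : List (E →ₗ[K] K))
    (l₂ : List (E × (E →ₗ[K] K))) (h₁ : ∀ φ ∈ l₁, ∀ b ∈ l₂, φ b.1 = 0)
    (h₂ : ∀ a ∈ l₂, ∀ b ∈ l₂, a.2 b.1 = 0) (w : ExteriorAlgebra K E) :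
    ExteriorAlgebra.algebraMapInv ((l₁.map contract).prod ((l₂.map fun a =>
        LinearMap.mulLeft K (ExteriorAlgebra.ι K a.1) + contract a.2).prod w)) =
      ExteriorAlgebra.algebraMapInv ((l₁.map contract).prod
        ((l₂.map fun a => contract a.2).prod w)) := by
  induction l₂ generalizing l₁ with
  | nil => rfl
  | cons a l₂ ih =>
    have ih' := ih (l₁ ++ [a.2]) (fun φ hφ b hb => by
      rcases List.mem_append.1 hφ with hφ | hφ
      · exact h₁ φ hφ b (List.mem_cons_of_mem _ hb)
      · rw [List.mem_singleton.1 hφ]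
        exact h₂ a List.mem_cons_self b (List.mem_cons_of_mem _ hb))
      fun b hb c hc => h₂ b (List.mem_cons_of_mem _ hb) c (List.mem_cons_of_mem _ hc)
    simp only [List.map_append, List.map_cons, List.map_nil, List.prod_append,
      List.prod_singleton, Module.End.mul_apply] at ih'
    simp only [List.map_cons, List.prod_cons, Module.End.mul_apply, LinearMap.add_apply,
      LinearMap.mulLeft_apply, map_add]
    obtain ⟨w', hw'⟩ := exists_prod_contract_ι_mul l₁ a.1
      (fun φ hφ => h₁ φ hφ a List.mem_cons_self)
      ((l₂.map fun a => LinearMap.mulLeft K (ExteriorAlgebra.ι K a.1) + contract a.2).prod w)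
    rw [hw', algebraMapInv_ι_mul, zero_add, ih']

/-- Contraction as an alternating sum over the omitted factor. -/
theorem contract_prod_ofFn_ι (φ : E →ₗ[K] K) {n : ℕ} (v : Fin (n + 1) → E) :
    contract φ (List.ofFn fun j => ExteriorAlgebra.ι K (v j)).prod =
      ∑ j : Fin (n + 1), ((-1) ^ (j : ℕ) * φ (v j)) •
        (List.ofFn fun k => ExteriorAlgebra.ι K (v (j.succAbove k))).prod := by
  induction n with
  | zero =>
    have := contract_ι_mul φ (v 0) 1
    simpa [contract] using this
  | succ n ih =>
    rw [List.ofFn_succ, List.prod_cons, contract_ι_mul, ih fun j => v j.succ,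
      Fin.sum_univ_succ (n := n + 1), sub_eq_add_neg, Finset.mul_sum, ← Finset.sum_neg_distrib]
    congr 1
    · simp
    · refine Finset.sum_congr rfl fun j _ => ?_
      rw [List.ofFn_succ, List.prod_cons, mul_smul_comm, ← neg_smul]
      simp only [Fin.succ_succAbove_zero, Fin.succ_succAbove_succ, Fin.val_succ, pow_succ]
      congr 1
      ring

/-- The contractions act from the right end of the product, hence the reversal of the rows. -/
theorem algebraMapInv_prod_contract_prod_ι {n : ℕ} (φ : Fin n → E →ₗ[K] K) (v : Fin n → E) :
    ExteriorAlgebra.algebraMapInv ((List.ofFn fun i => contract (φ i)).prod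
        (List.ofFn fun j => ExteriorAlgebra.ι K (v j)).prod) =
      Matrix.det (Matrix.of fun i j => φ i.rev (v j)) := by
  induction n with
  | zero => simp
  | succ n ih =>
    rw [List.ofFn_succ' (fun i => contract (φ i)), List.concat_eq_append, List.prod_append,
      List.prod_singleton, Module.End.mul_apply, contract_prod_ofFn_ι, map_sum, map_sum,
      Matrix.det_succ_row_zero]
    refine Finset.sum_congr rfl fun j _ => ?_
    rw [map_smul, map_smul, ih (fun i => φ i.castSucc) (fun k => v (j.succAbove k)), smul_eq_mul]
    congr 1
    refine congrArg Matrix.det (Matrix.ext fun i k => ?_)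
    simp [Fin.rev_succ]

end Wick

theorem shiftedVac_neg (r : ℕ) : (shiftedVac (-(r : ℤ)) : Fock K) =
    (List.ofFn fun j : Fin r =>
      ExteriorAlgebra.ι K (Finsupp.single (-(r : ℤ) + j) (1 : K))).prod := by
  have h : ∀ r : ℕ, (vacNeg r : Fock K) = (List.ofFn fun j : Fin r =>
      ExteriorAlgebra.ι K (Finsupp.single (-(r : ℤ) + j) (1 : K))).prod := by
    intro r
    induction r with
    | zero => simp [vacNeg, vac]
    | succ r ih =>
      rw [vacNeg, psiStar, if_neg (by omega), ih, create, LinearMap.mulLeft_apply,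
        List.ofFn_succ, List.prod_cons]
      have h0 : -((r : ℤ) + 1) = -((r + 1 : ℕ) : ℤ) + ((0 : Fin (r + 1)) : ℕ) := by simp
      rw [h0]
      congr 2
      refine congrArg List.ofFn (funext fun j => ?_)
      rw [Fin.val_succ, show -((r + 1 : ℕ) : ℤ) + ((j + 1 : ℕ) : ℤ) = -(r : ℤ) + j by
        push_cast; ring]
  rw [shiftedVac]
  split_ifs with hr
  · obtain rfl : r = 0 := by omega
    simp [vacPos, vac]
  · rw [neg_neg, Int.toNat_natCast, h]

end MultiSchur

end

theorem proposition2p3 {K : Type*} [Field K] [CharZero K] {r : ℕ} (lam : Fin r → ℕ)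
    (hlam : Antitone lam) {M N : Fin r → ℕ}
    (x : ∀ i : Fin r, Fin (M i) → K) (y : ∀ i : Fin r, Fin (N i) → K) :
    MultiSchur.fermionicS lam x y =
      Matrix.det (Matrix.of fun i j : Fin r =>
        MultiSchur.complete (x i) (y i) ((lam i : ℤ) - (i : ℤ) + (j : ℤ))) := by
  open MultiSchur in
  let m : Fin r → ℤ := fun i => (lam i : ℤ) - ((i : ℤ) + 1)
  let f : Fin r → PowerSeries K := fun i => completeSeries (x i) (y i)
  let φ : Fin r → (ℤ →₀ K) →ₗ[K] K := fun i => negPart (m i) (f i)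
  let u : Fin r → ℤ →₀ K := fun i => posPart (m i) (f i)
  have hfac : ∀ i, expH (x i) (y i) * psi (m i) * expNegH (x i) (y i) =
      LinearMap.mulLeft K (ExteriorAlgebra.ι K (u i)) + contract (φ i) := fun i => by
    rw [expH_psi_expNegH, expSeries_eq_completeSeries, psiSeries_eq_mulLeft_add_contractLeft]
  have hwick := algebraMapInv_prod_mulLeft_add_contract [] (List.ofFn fun i => (u i, φ i))
    (by simp) (by simp [List.mem_ofFn, u, φ, negPart_posPart])
    (shiftedVac (-(r : ℤ)))
  rw [List.map_ofFn, List.map_ofFn] at hwick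
  have hS : fermionicS lam x y = ExteriorAlgebra.algebraMapInv
      ((List.ofFn fun i => contract (φ i)).prod (shiftedVac (-(r : ℤ)))) := by
    refine Eq.trans ?_ hwick
    rw [fermionicS]
    exact congrArg (fun F : Fin r → Module.End K (Fock K) => bra0 ((List.ofFn F).prod (shiftedVac (-(r : ℤ))))) (funext hfac)
  rw [hS, shiftedVac_neg, algebraMapInv_prod_contract_prod_ι,
    ← Matrix.det_submatrix_equiv_self Fin.revPerm]
  congr 1
  ext i j
  -- Reversing rows and columns turns the factors `e_{-r}, …, e_{-1}` of `|-r⟩` into `e_{-(j+1)}`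
  -- and restores the order of the rows.
  have hj : (-(r : ℤ) + (j.rev : ℕ)) = -((j : ℤ) + 1) := by
    rw [Fin.val_rev]
    omega
  rw [Matrix.submatrix_apply, Matrix.of_apply, Matrix.of_apply, Fin.revPerm_apply,
    Fin.revPerm_apply, Fin.rev_rev, hj, negPart_single, complete_eq_coeff]
  simp only [m]
  refine if_congr (by omega) ?_ rfl
  exact congrArg (fun n : ℕ => PowerSeries.coeff n (f i)) (by omega)
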